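/- Let $M$ be a compact connected complex manifold and $L$ a holomorphic line bundle on $M$; write $kL=L^{\otimes k}$. Say that $kL$ is \emph{very ample} if there are finitely many sections $s_0,\dots,s_N\in H^0(M,kL)$ without common zeros such that $p\mapsto[s_0(p):\dots:s_N(p)]$ is an embedding of $M$ in $\mathbb{P}^N$ (that is, it is injective and its differential is injective at every point), and that $L$ is \emph{ample} if $kL$ is very ample for some $k\ge 1$. Say that $L$ is \emph{effective} if $H^0(M,L)\neq 0$, and that $L$ is \emph{$2$-generated} if the graded $\mathbb{C}$-algebra $G(M,L)=\bigoplus_{i\ge 1}H^0(M,iL)$ is generated by the elements of $H^0(M,L)$ and $H^0(M,2L)$. If $L$ is ample, effective and $2$-generated (so that $(M,L)$ is a polarized manifold), then $2L$ is very ample. -/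

import Mathlib

open scoped Manifold ContDiff DirectSum
open Bundle

namespace Polarized

noncomputable section

variable (n : ℕ) {M : Type*} [TopologicalSpace M] [ChartedSpace (EuclideanSpace ℂ (Fin n)) M]
variable (L : M → Type*) [∀ x, AddCommGroup (L x)] [∀ x, Module ℂ (L x)]
variable [TopologicalSpace (TotalSpace ℂ L)] [∀ x, TopologicalSpace (L x)]
variable [FiberBundle ℂ L] [VectorBundle ℂ ℂ L]

/-- All set-theoretic sections of the bundle of tensor algebras `x ↦ T(L x) = ⨁ₖ (L x)^{⊗k}`.
The fibre at `x` of the tensor power `kL = L^{⊗k}` is the degree `k` part of `T(L x)`. -/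
abbrev TensorSections : Type _ := (x : M) → TensorAlgebra ℂ (L x)

variable {L} in
/-- The coordinate on `T(L x)` induced by a local trivialization `e` of the line bundle `L`: the
algebra map sending `v₁ ⊗ ⋯ ⊗ vₖ` to `e(v₁) ⋯ e(vₖ)`. For `x` in the base set of `e`, its
restriction to `(L x)^{⊗k}` is the local trivialization of `kL` induced by `e`. -/
def tensorCoord (e : Trivialization ℂ (π ℂ L)) [MemTrivializationAtlas e] (x : M) :
    TensorAlgebra ℂ (L x) →ₐ[ℂ] ℂ :=
  TensorAlgebra.lift ℂ (e.linearMapAt ℂ x)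

/-- `H⁰(M, kL)`: the holomorphic sections of `kL`. A section of `kL` is holomorphic when its
coordinate in every local trivialization of `L` is a holomorphic function. -/
def H0 (k : ℕ) : Submodule ℂ (TensorSections L) where
  carrier := {s | (∀ x, s x ∈ LinearMap.range (TensorAlgebra.ι ℂ : L x →ₗ[ℂ] _) ^ k) ∧
    ∀ (e : Trivialization ℂ (π ℂ L)) [MemTrivializationAtlas e],
      MDifferentiableOn 𝓘(ℂ, EuclideanSpace ℂ (Fin n)) 𝓘(ℂ, ℂ)
        (fun x => tensorCoord e x (s x)) e.baseSet}
  zero_mem' := ⟨fun x => zero_mem _, fun e _ => by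
    simpa using mdifferentiableOn_const⟩
  add_mem' := fun {a b} ha hb => ⟨fun x => add_mem (ha.1 x) (hb.1 x), fun e _ => by
    simpa [Pi.add_def] using (ha.2 e).add (hb.2 e)⟩
  smul_mem' := fun c a ha => ⟨fun x => Submodule.smul_mem _ c (ha.1 x), fun e _ => by
    simpa [Pi.smul_def] using (ha.2 e).const_smul c⟩

/-- The product of sections of `iL` and `jL` is a section of `(i+j)L`. -/
instance : SetLike.GradedMonoid (H0 n L) where
  one_mem := ⟨fun x => by simp, fun e _ => by
    simpa using mdifferentiableOn_const⟩
  mul_mem := fun i j a b ha hb => ⟨fun x => by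
    rw [pow_add]; exact Submodule.mul_mem_mul (ha.1 x) (hb.1 x), fun e _ => by
    simpa [Pi.mul_def] using (ha.2 e).mul (hb.2 e)⟩

instance : IsScalarTower ℂ (⨁ i, H0 n L i) (⨁ i, H0 n L i) :=
  IsScalarTower.right (R := ℂ) (A := ⨁ i, H0 n L i)

instance : SMulCommClass ℂ (⨁ i, H0 n L i) (⨁ i, H0 n L i) :=
  Algebra.to_smulCommClass (R := ℂ) (A := ⨁ i, H0 n L i)

/-- The graded algebra `G(M, L) = ⨁_{i ≥ 1} H⁰(M, iL)`, as the (non-unital) subalgebra of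
`⨁_{i ≥ 0} H⁰(M, iL)` of the elements whose component in degree `0` vanishes. -/
def G : NonUnitalSubalgebra ℂ (⨁ i, H0 n L i) where
  carrier := {x | x 0 = 0}
  zero_mem' := rfl
  add_mem' := fun {a b} ha hb => by
    simp only [Set.mem_ofPred_eq] at *
    simp [ha, hb]
  smul_mem' := fun c a ha => by
    simp only [Set.mem_ofPred_eq] at *
    rw [DirectSum.smul_apply, ha, smul_zero]
  mul_mem' := fun {a b} ha hb => by
    simp only [Set.mem_ofPred_eq] at *
    apply Subtype.ext
    rw [DirectSum.coe_mul_apply_eq_sum_antidiagonal]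
    simp [ha]

/-- `L` is `r`-generated: the algebra `G(M, L)` is generated by the sections in
`H⁰(M, L), …, H⁰(M, rL)`. -/
def IsGenerated (r : ℕ) : Prop :=
  NonUnitalAlgebra.adjoin ℂ
    {x | ∃ i, 1 ≤ i ∧ i ≤ r ∧ ∃ s : H0 n L i, x = DirectSum.of (fun i => H0 n L i) i s} = G n L

/-- `L` is effective: it has a nonzero holomorphic section. -/
def IsEffective : Prop := ∃ s ∈ H0 n L 1, s ≠ 0

variable {n L} in
/-- The homogeneous coordinates `(s₀(p), …, s_N(p))` of a point `p` for a tuple of sections of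
`kL`, computed in the preferred local trivialization of `L` at `p`; another trivialization changes
them by a common nonzero factor. -/
def homogCoords {k N : ℕ} (s : Fin (N + 1) → H0 n L k) (p : M) : Fin (N + 1) → ℂ :=
  fun i => tensorCoord (trivializationAt ℂ L p) p ((s i : TensorSections L) p)

/-- `kL` is very ample: there are sections `s₀, …, s_N ∈ H⁰(M, kL)` without common zeros such that
`p ↦ [s₀(p) : ⋯ : s_N(p)]` is an embedding of `M` in `ℙᴺ`, that is (as `M` is compact) it is
injective and an immersion. The latter is expressed in the affine charts of `ℙᴺ`: where
`s_j ≠ 0`, the map `p ↦ (s₀(p)/s_j(p), …, s_N(p)/s_j(p))` has injective differential. -/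
def IsVeryAmple (k : ℕ) : Prop :=
  ∃ (N : ℕ) (s : Fin (N + 1) → H0 n L k) (hs : ∀ p, homogCoords s p ≠ 0),
    Function.Injective (fun p => Projectivization.mk ℂ (homogCoords s p) (hs p)) ∧
    ∀ (p : M) (j : Fin (N + 1)), homogCoords s p j ≠ 0 →
      Function.Injective
        (mfderiv 𝓘(ℂ, EuclideanSpace ℂ (Fin n)) 𝓘(ℂ, Fin (N + 1) → ℂ)
          (fun x i => homogCoords s x i / homogCoords s x j) p)

/-- `L` is ample: some positive multiple `kL` is very ample. -/
def IsAmple : Prop := ∃ k, 1 ≤ k ∧ IsVeryAmple n L k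

end

end Polarized

/-! Let sections `sᵢ` of `kL` embed `M`. Each product `sᵢ sⱼ` lies in `H⁰(M, 2kL)`, so by
2-generation it is a polynomial in sections of `L` and `2L`. Its degree is even, so the factors from
`L` pair off into sections of `2L`, leaving a homogeneous polynomial of degree `k` in sections of
`2L` (`IsGenerated.mem_pow`). Finitely many sections `t` of `2L` serve all pairs.

These `t` embed `M`: the ratios of the `tᵢ` determine those of the products `sᵢ sₗ`, hence `sᵢ / sₗ
= sᵢ sₗ / sₗ²`. So common zeros, pairs of points identified by `t` and tangent vectors killed by `t`
are all inherited by `s` (`IsVeryAmple.two_of_forall_mem_pow`). -/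

open scoped Manifold ContDiff DirectSum Topology
open Bundle

namespace Polarized

/-! ### Functions whose differential kills a given tangent vector -/

section StationaryAlong

variable {E : Type*} [NormedAddCommGroup E] [NormedSpace ℂ E]
  {H : Type*} [TopologicalSpace H] (I : ModelWithCorners ℂ E H)
  {M : Type*} [TopologicalSpace M] [ChartedSpace H M]
  {F : Type*} [NormedAddCommGroup F] [NormedSpace ℂ F]

/-- The map `f` is differentiable at `p` and its differential there kills the tangent vector `v`. -/
def StationaryAlong (p : M) (v : TangentSpace I p) (f : M → F) : Prop :=
  ∃ f' : TangentSpace I p →L[ℂ] F, HasMFDerivAt I 𝓘(ℂ, F) f p f' ∧ f' v = 0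

variable {I} {p : M} {v : TangentSpace I p}

theorem StationaryAlong.mfderiv_apply {f : M → F} (h : StationaryAlong I p v f) :
    mfderiv I 𝓘(ℂ, F) f p v = 0 := by
  obtain ⟨f', hf, hv⟩ := h
  rw [hf.mfderiv]
  exact hv

theorem stationaryAlong_of_mfderiv {f : M → F} (hf : MDifferentiableAt I 𝓘(ℂ, F) f p)
    (h : mfderiv I 𝓘(ℂ, F) f p v = 0) : StationaryAlong I p v f :=
  ⟨_, hf.hasMFDerivAt, h⟩

theorem StationaryAlong.congr {f g : M → F} (h : StationaryAlong I p v f) (hfg : g =ᶠ[𝓝 p] f) :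
    StationaryAlong I p v g := by
  obtain ⟨f', hf, hv⟩ := h
  exact ⟨f', hf.congr_of_eventuallyEq hfg, hv⟩

theorem stationaryAlong_const (c : F) : StationaryAlong I p v (fun _ => c) :=
  ⟨0, hasMFDerivAt_const c p, rfl⟩

theorem StationaryAlong.add {f g : M → F} (hf : StationaryAlong I p v f)
    (hg : StationaryAlong I p v g) : StationaryAlong I p v (fun x => f x + g x) := by
  obtain ⟨f', hf, hf0⟩ := hf
  obtain ⟨g', hg, hg0⟩ := hg
  refine ⟨f' + g', hf.add hg, ?_⟩
  rw [add_apply, hf0, hg0, add_zero]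

theorem StationaryAlong.mul {f g : M → ℂ} (hf : StationaryAlong I p v f)
    (hg : StationaryAlong I p v g) : StationaryAlong I p v (fun x => f x * g x) := by
  obtain ⟨f', hf, hf0⟩ := hf
  obtain ⟨g', hg, hg0⟩ := hg
  refine ⟨f p • g' + g p • f', hf.mul hg, ?_⟩
  rw [add_apply, smul_apply,
    smul_apply, hf0, hg0, smul_zero, smul_zero, add_zero]

theorem StationaryAlong.inv {f : M → ℂ} (hf : StationaryAlong I p v f) (h0 : f p ≠ 0) :
    StationaryAlong I p v (fun x => (f x)⁻¹) := by
  obtain ⟨f', hf, hf0⟩ := hf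
  refine ⟨_, HasMFDerivAt.comp p (hasDerivAt_inv h0).hasFDerivAt.hasMFDerivAt hf, ?_⟩
  exact (congrArg (ContinuousLinearMap.toSpanSingleton ℂ (-(f p ^ 2)⁻¹)) hf0).trans (map_zero _)

theorem StationaryAlong.div {f g : M → ℂ} (hf : StationaryAlong I p v f)
    (hg : StationaryAlong I p v g) (h0 : g p ≠ 0) :
    StationaryAlong I p v (fun x => f x / g x) := by
  simpa only [div_eq_mul_inv] using hf.mul (hg.inv h0)

theorem hasMFDerivAt_pi {ι : Type*} [Fintype ι] {f : M → ι → F}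
    {f' : ι → TangentSpace I p →L[ℂ] F}
    (h : ∀ i, HasMFDerivAt I 𝓘(ℂ, F) (fun x => f x i) p (f' i)) :
    HasMFDerivAt I 𝓘(ℂ, ι → F) f p (ContinuousLinearMap.pi f') :=
  ⟨continuousAt_pi.2 fun i => (h i).1, hasFDerivWithinAt_pi.2 fun i => (h i).2⟩

theorem StationaryAlong.pi {ι : Type*} [Fintype ι] {f : M → ι → F}
    (h : ∀ i, StationaryAlong I p v (fun x => f x i)) : StationaryAlong I p v f := by
  choose f' hf hv using h
  exact ⟨_, hasMFDerivAt_pi hf, funext hv⟩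

theorem StationaryAlong.apply {ι : Type*} [Fintype ι] {f : M → ι → F}
    (h : StationaryAlong I p v f) (i : ι) : StationaryAlong I p v (fun x => f x i) := by
  obtain ⟨f', hf, hf0⟩ := h
  refine ⟨(ContinuousLinearMap.proj (R := ℂ) (φ := fun _ : ι => F) i).comp f',
    HasMFDerivAt.comp p
      (ContinuousLinearMap.proj (R := ℂ) (φ := fun _ : ι => F) i).hasMFDerivAt hf, ?_⟩
  exact congrFun hf0 i

end StationaryAlong

/-! ### Powers of submodules in an algebra -/

section PowersOfSubmodules

/-- A polynomial expression involves only finitely many elements of `W`. This supplies the finite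
family of sections that very ampleness asks for, without finite-dimensionality of `H⁰`. -/
theorem exists_fg_le_mem_pow {R A : Type*} [CommSemiring R] [Semiring A] [Algebra R A]
    {W : Submodule R A} {k : ℕ} {u : A} (hu : u ∈ W ^ k) :
    ∃ V : Submodule R A, V.FG ∧ V ≤ W ∧ u ∈ V ^ k := by
  induction hu using Submodule.pow_induction_on_left' with
  | algebraMap r => exact ⟨⊥, Submodule.fg_bot, bot_le, by simp⟩
  | add x y i hx hy ihx ihy =>
    obtain ⟨V, hV, hVW, hxV⟩ := ihx
    obtain ⟨V', hV', hVW', hyV⟩ := ihy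
    exact ⟨V ⊔ V', hV.sup hV', sup_le hVW hVW', add_mem
      (SetLike.le_def.1 (pow_le_pow_left' le_sup_left i) hxV)
      (SetLike.le_def.1 (pow_le_pow_left' le_sup_right i) hyV)⟩
  | mem_mul m hm i x hx ih =>
    obtain ⟨V, hV, hVW, hxV⟩ := ih
    refine ⟨Submodule.span R {m} ⊔ V, (Submodule.fg_span_singleton m).sup hV,
      sup_le ((Submodule.span_singleton_le_iff_mem _ _).2 hm) hVW, ?_⟩
    rw [Nat.succ_eq_add_one, pow_succ']
    exact Submodule.mul_mem_mul (Submodule.mem_sup_left (Submodule.mem_span_singleton_self m))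
      (SetLike.le_def.1 (pow_le_pow_left' le_sup_right i) hxV)

theorem exists_fg_le_forall_mem_pow {R A ι : Type*} [CommSemiring R] [Semiring A] [Algebra R A]
    [Finite ι] {W : Submodule R A} {k : ℕ} {u : ι → A} (hu : ∀ i, u i ∈ W ^ k) :
    ∃ V : Submodule R A, V.FG ∧ V ≤ W ∧ ∀ i, u i ∈ V ^ k := by
  choose V hV hVW huV using fun i => exists_fg_le_mem_pow (hu i)
  exact ⟨⨆ i, V i, Submodule.fg_iSup V hV, iSup_le hVW,
    fun i => pow_le_pow_left' (le_iSup V i) k (huV i)⟩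

/-- A nonempty finite generating family of a finitely generated submodule. -/
theorem exists_fin_succ_generating_family {R A : Type*} [Semiring R] [AddCommMonoid A]
    [Module R A] {V : Submodule R A} (hV : V.FG) :
    ∃ (N : ℕ) (t : Fin (N + 1) → A), Submodule.span R (Set.range t) = V := by
  obtain ⟨N, t, rfl⟩ := Submodule.fg_iff_exists_fin_generating_family.1 hV
  -- The added zero makes the family nonempty, even when `V = ⊥`, and leaves the span unchanged.
  exact ⟨N, Fin.cons 0 t, by rw [Fin.range_cons, Submodule.span_insert_zero]⟩

/-- Two algebra maps that are proportional on `V` with factor `c` are proportional on `V ^ k` with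
factor `c ^ k`. -/
theorem algHom_apply_eq_pow_mul {R A B : Type*} [CommSemiring R] [Semiring A] [CommSemiring B]
    [Algebra R A] [Algebra R B] {V : Submodule R A} {φ ψ : A →ₐ[R] B} {c : B}
    (h : ∀ w ∈ V, φ w = c * ψ w) {k : ℕ} {u : A} (hu : u ∈ V ^ k) : φ u = c ^ k * ψ u := by
  induction hu using Submodule.pow_induction_on_left' with
  | algebraMap r => simp
  | add x y i hx hy ihx ihy => rw [map_add, map_add, ihx, ihy, mul_add]
  | mem_mul m hm i x hx ih => rw [map_mul, map_mul, ih, h m hm, Nat.succ_eq_add_one]; ring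

theorem forall_mem_span_range_eq_mul {R A B ι : Type*} [CommSemiring R] [Semiring A]
    [CommSemiring B] [Algebra R A] [Algebra R B] {φ ψ : A →ₐ[R] B} {c : B} {t : ι → A}
    (h : ∀ i, φ (t i) = c * ψ (t i)) :
    ∀ w ∈ Submodule.span R (Set.range t), φ w = c * ψ w := by
  intro w hw
  induction hw using Submodule.span_induction with
  | mem x hx => obtain ⟨i, rfl⟩ := hx; exact h i
  | zero => simp
  | add x y _ _ hx hy => rw [map_add, map_add, hx, hy, mul_add]
  | smul a x _ hx => rw [map_smul, map_smul, hx, mul_smul_comm]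

end PowersOfSubmodules

/-! ### Sections of powers of a line bundle and their coordinates -/

section Sections

variable {n : ℕ} {M : Type*} [TopologicalSpace M] [ChartedSpace (EuclideanSpace ℂ (Fin n)) M]
  {L : M → Type*} [∀ x, AddCommGroup (L x)] [∀ x, Module ℂ (L x)]
  [TopologicalSpace (TotalSpace ℂ L)] [∀ x, TopologicalSpace (L x)]
  [FiberBundle ℂ L] [VectorBundle ℂ ℂ L]

/-- Any two vectors of a line are multiples of a single one, so the generators of the tensor algebra
commute. -/
theorem tensorAlgebra_commute_of_linearEquiv {V : Type*} [AddCommGroup V] [Module ℂ V]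
    (f : V ≃ₗ[ℂ] ℂ) (a b : TensorAlgebra ℂ V) : Commute a b := by
  have hι : ∀ v w : V, Commute (TensorAlgebra.ι ℂ v) (TensorAlgebra.ι ℂ w) := by
    have h1 : ∀ v : V, v = f v • f.symm 1 := fun v => by
      rw [← map_smul, smul_eq_mul, mul_one, f.symm_apply_apply]
    intro v w
    rw [h1 v, h1 w, map_smul, map_smul]
    exact ((Commute.refl _).smul_left _).smul_right _
  induction a using TensorAlgebra.induction with
  | algebraMap r => exact Algebra.commutes r b
  | ι v =>
    induction b using TensorAlgebra.induction with
    | algebraMap r => exact (Algebra.commutes r _).symm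
    | ι w => exact hι v w
    | mul x y hx hy => exact hx.mul_right hy
    | add x y hx hy => exact hx.add_right hy
  | mul x y hx hy => exact hx.mul_left hy
  | add x y hx hy => exact hx.add_left hy

theorem tensorSections_commute (a b : TensorSections L) : Commute a b :=
  funext fun x => tensorAlgebra_commute_of_linearEquiv
    ((trivializationAt ℂ L x).linearEquivAt ℂ x (mem_baseSet_trivializationAt ℂ L x)) (a x) (b x)

/-- Passing from one local trivialization of `L` to another multiplies the coordinates of the
elements of `(L x)^{⊗k}` by the `k`-th power of a nonzero number. -/
theorem exists_tensorCoord_eq (e e' : Trivialization ℂ (π ℂ L)) [MemTrivializationAtlas e]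
    [MemTrivializationAtlas e'] {x : M} (hx : x ∈ e.baseSet) (hx' : x ∈ e'.baseSet) :
    ∃ c : ℂ, c ≠ 0 ∧ ∀ (k : ℕ), ∀ u ∈ LinearMap.range (TensorAlgebra.ι ℂ : L x →ₗ[ℂ] _) ^ k,
      tensorCoord e x u = c ^ k * tensorCoord e' x u := by
  let f := e.linearEquivAt ℂ x hx
  let f' := e'.linearEquivAt ℂ x hx'
  have hf : e.linearMapAt ℂ x = f := e.linearMapAt_def_of_mem hx
  have hf' : e'.linearMapAt ℂ x = f' := e'.linearMapAt_def_of_mem hx'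
  refine ⟨f (f'.symm 1), by simp, fun k u hu => algHom_apply_eq_pow_mul ?_ hu⟩
  rintro _ ⟨w, rfl⟩
  rw [tensorCoord, tensorCoord, TensorAlgebra.lift_ι_apply, TensorAlgebra.lift_ι_apply, hf, hf']
  have : w = f' w • f'.symm 1 := by
    rw [← map_smul, smul_eq_mul, mul_one, f'.symm_apply_apply]
  calc f w = f (f' w • f'.symm 1) := by rw [← this]
    _ = _ := by rw [map_smul, smul_eq_mul, mul_comm]; rfl

/-- The common factor `c ^ k` cancels. `homogCoords` changes trivialization with the point, so only
quotients can be differentiated, after passing to one fixed `e`. -/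
theorem homogCoords_div_eq {k N : ℕ} (s : Fin (N + 1) → H0 n L k)
    (e : Trivialization ℂ (π ℂ L)) [MemTrivializationAtlas e] {x : M} (hx : x ∈ e.baseSet)
    (i j : Fin (N + 1)) :
    homogCoords s x i / homogCoords s x j =
      tensorCoord e x ((s i : TensorSections L) x) /
        tensorCoord e x ((s j : TensorSections L) x) := by
  obtain ⟨c, hc, h⟩ := exists_tensorCoord_eq (trivializationAt ℂ L x) e
    (mem_baseSet_trivializationAt ℂ L x) hx
  rw [homogCoords, homogCoords, h k _ ((s i).2.1 x), h k _ ((s j).2.1 x),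
    mul_div_mul_left _ _ (pow_ne_zero k hc)]

theorem homogCoords_div_eventuallyEq {k N : ℕ} (s : Fin (N + 1) → H0 n L k) (p : M)
    (i j : Fin (N + 1)) :
    (fun x => homogCoords s x i / homogCoords s x j) =ᶠ[𝓝 p] fun x =>
      tensorCoord (trivializationAt ℂ L p) x ((s i : TensorSections L) x) /
        tensorCoord (trivializationAt ℂ L p) x ((s j : TensorSections L) x) := by
  filter_upwards [(trivializationAt ℂ L p).open_baseSet.mem_nhds
    (mem_baseSet_trivializationAt ℂ L p)] with x hx
  exact homogCoords_div_eq s _ hx i j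

theorem mdifferentiableAt_tensorCoord {k : ℕ} (s : H0 n L k) (p : M) :
    MDifferentiableAt 𝓘(ℂ, EuclideanSpace ℂ (Fin n)) 𝓘(ℂ, ℂ)
      (fun x => tensorCoord (trivializationAt ℂ L p) x ((s : TensorSections L) x)) p :=
  (s.2.2 (trivializationAt ℂ L p)).mdifferentiableAt
    ((trivializationAt ℂ L p).open_baseSet.mem_nhds (mem_baseSet_trivializationAt ℂ L p))

theorem mdifferentiableAt_homogCoords_div {k N : ℕ} (s : Fin (N + 1) → H0 n L k) {p : M}
    {j : Fin (N + 1)} (hj : homogCoords s p j ≠ 0) :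
    MDifferentiableAt 𝓘(ℂ, EuclideanSpace ℂ (Fin n)) 𝓘(ℂ, Fin (N + 1) → ℂ)
      (fun x i => homogCoords s x i / homogCoords s x j) p := by
  refine (hasMFDerivAt_pi fun i => MDifferentiableAt.hasMFDerivAt ?_).mdifferentiableAt
  exact ((mdifferentiableAt_tensorCoord (s i) p).div
    (mdifferentiableAt_tensorCoord (s j) p) hj).congr_of_eventuallyEq
    (homogCoords_div_eventuallyEq s p i j)

/-! ### Consequences of 2-generation -/

variable (n L) in
/-- The sections of `mL` that are polynomials in sections of `L` and `2L`: combinations of products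
of sections of `2L`, times one section of `L` if `m` is odd. -/
def quadraticPart (m : ℕ) : Submodule ℂ (TensorSections L) :=
  H0 n L 1 ^ (m % 2) * H0 n L 2 ^ (m / 2)

/-- Commutativity gathers the factors from `L`; if both degrees are odd there are two of them, and
their product is a section of `2L`. -/
theorem quadraticPart_mul_le (i j : ℕ) :
    quadraticPart n L i * quadraticPart n L j ≤ quadraticPart n L (i + j) := by
  have hcomm : ∀ P Q : Submodule ℂ (TensorSections L), P * Q = Q * P := fun P Q =>
    Submodule.mul_comm_of_commute fun a _ b _ => tensorSections_commute a b
  have hsq : H0 n L 1 * H0 n L 1 ≤ H0 n L 2 :=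
    Submodule.mul_le.2 fun a ha b hb => SetLike.mul_mem_graded (A := H0 n L) ha hb
  have hswap : quadraticPart n L i * quadraticPart n L j =
      H0 n L 1 ^ (i % 2 + j % 2) * H0 n L 2 ^ (i / 2 + j / 2) := by
    rw [quadraticPart, quadraticPart, pow_add, pow_add, mul_assoc, mul_assoc,
      ← mul_assoc (H0 n L 2 ^ (i / 2)), hcomm (H0 n L 2 ^ (i / 2)), mul_assoc]
  rw [hswap, quadraticPart]
  rcases Nat.lt_or_ge (i % 2 + j % 2) 2 with h | h
  · rw [show (i + j) % 2 = i % 2 + j % 2 by omega, show (i + j) / 2 = i / 2 + j / 2 by omega]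
  · rw [show (i + j) % 2 = 0 by omega, show (i + j) / 2 = 1 + (i / 2 + j / 2) by omega,
      show i % 2 + j % 2 = 2 by omega, pow_zero, one_mul, pow_two, pow_add _ 1, pow_one]
    exact mul_le_mul' hsq le_rfl

variable (n L) in
/-- The elements of `⨁ H⁰(M, iL)` whose components are polynomials in sections of `L` and `2L`. -/
def quadraticSubalgebra : NonUnitalSubalgebra ℂ (⨁ i, H0 n L i) where
  carrier := {x | ∀ i, ((x i : H0 n L i) : TensorSections L) ∈ quadraticPart n L i}
  zero_mem' := fun i => zero_mem _
  add_mem' := fun {a b} ha hb i => by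
    rw [DirectSum.add_apply]
    exact add_mem (ha i) (hb i)
  smul_mem' := fun c a ha i => by
    rw [DirectSum.smul_apply]
    exact Submodule.smul_mem _ c (ha i)
  mul_mem' := fun {a b} ha hb i => by
    rw [DirectSum.coe_mul_apply_eq_sum_antidiagonal]
    refine sum_mem fun ij hij => ?_
    rw [← Finset.HasAntidiagonal.mem_antidiagonal.1 hij]
    exact quadraticPart_mul_le _ _ (Submodule.mul_mem_mul (ha ij.1) (hb ij.2))

theorem IsGenerated.mem_quadraticPart (hgen : IsGenerated n L 2) {m : ℕ} (hm : 1 ≤ m)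
    {u : TensorSections L} (hu : u ∈ H0 n L m) : u ∈ quadraticPart n L m := by
  have hle : G n L ≤ quadraticSubalgebra n L := by
    rw [← hgen]
    refine NonUnitalAlgebra.adjoin_le ?_
    rintro _ ⟨i, hi1, hi2, s, rfl⟩ j
    rcases eq_or_ne i j with rfl | hij
    · rw [DirectSum.of_eq_same]
      obtain rfl | rfl : i = 1 ∨ i = 2 := by omega
      · simp [quadraticPart]
      · simp [quadraticPart]
    · rw [DirectSum.of_eq_of_ne _ _ _ hij.symm]
      exact zero_mem _
  have hG : DirectSum.of (fun i => H0 n L i) m ⟨u, hu⟩ ∈ G n L :=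
    DirectSum.of_eq_of_ne _ _ _ (by omega)
  have := hle hG m
  rwa [DirectSum.of_eq_same] at this

theorem IsGenerated.mem_pow (hgen : IsGenerated n L 2) {k : ℕ} (hk : 1 ≤ k)
    {u : TensorSections L} (hu : u ∈ H0 n L (k + k)) : u ∈ H0 n L 2 ^ k := by
  have := hgen.mem_quadraticPart (by omega) hu
  rwa [quadraticPart, show (k + k) % 2 = 0 by omega, show (k + k) / 2 = k by omega, pow_zero,
    one_mul] at this

/-! ### Transfer from `2L` to `mL` -/

/-- Quotients of coordinates of polynomials in the sections `tᵢ` are stationary along the tangent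
vectors along which all quotients `tᵢ / tⱼ` are. -/
theorem stationaryAlong_div_pow {E H : Type*} [NormedAddCommGroup E] [NormedSpace ℂ E]
    [TopologicalSpace H] {I : ModelWithCorners ℂ E H} {X : Type*} [TopologicalSpace X]
    [ChartedSpace H X] {A : Type*} [Semiring A] [Algebra ℂ A] {ι : Type*} {p : X}
    {v : TangentSpace I p} {φ : X → A →ₐ[ℂ] ℂ} {t : ι → A} {τ : A}
    (h : ∀ i, StationaryAlong I p v (fun x => φ x (t i) / φ x τ)) {k : ℕ} {u : A}
    (hu : u ∈ Submodule.span ℂ (Set.range t) ^ k) :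
    StationaryAlong I p v (fun x => φ x u / φ x τ ^ k) := by
  have hlin : ∀ w ∈ Submodule.span ℂ (Set.range t),
      StationaryAlong I p v (fun x => φ x w / φ x τ) := by
    intro w hw
    induction hw using Submodule.span_induction with
    | mem x hx => obtain ⟨i, rfl⟩ := hx; exact h i
    | zero => simpa using stationaryAlong_const (0 : ℂ)
    | add x y _ _ hx hy => simpa only [map_add, add_div] using hx.add hy
    | smul a x _ hx =>
      simpa only [map_smul, smul_eq_mul, mul_div_assoc] using (stationaryAlong_const a).mul hx
  induction hu using Submodule.pow_induction_on_left' with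
  | algebraMap r => simpa using stationaryAlong_const r
  | add x y i hx hy ihx ihy => simpa only [map_add, add_div] using ihx.add ihy
  | mem_mul m hm i x hx ih =>
    simpa only [map_mul, Nat.succ_eq_add_one, pow_succ', mul_div_mul_comm] using (hlin m hm).mul ih

/-- The coordinate of a section of the tensor algebra at a point, as an algebra map on sections. -/
noncomputable def sectionCoord (e : Trivialization ℂ (π ℂ L)) [MemTrivializationAtlas e] (x : M) :
    TensorSections L →ₐ[ℂ] ℂ :=
  (tensorCoord e x).comp (Pi.evalAlgHom ℂ (fun x => TensorAlgebra ℂ (L x)) x)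

variable {k m N N' : ℕ} {s : Fin (N' + 1) → H0 n L m} {t : Fin (N + 1) → H0 n L 2}

/-- If the products `sᵢ sⱼ` are homogeneous polynomials of degree `k ≥ 1` in the sections `t`, the
zeros common to all `tᵢ` are common to all `sᵢ`. -/
theorem homogCoords_ne_zero_of_mem_pow (hk : 1 ≤ k)
    (hst : ∀ i j, (s i * s j : TensorSections L) ∈
      Submodule.span ℂ (Set.range fun i => (t i : TensorSections L)) ^ k)
    {p : M} (hp : homogCoords s p ≠ 0) : homogCoords t p ≠ 0 := by
  obtain ⟨l, hl⟩ := Function.ne_iff.1 hp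
  intro h0
  -- Vanishing of all `tᵢ` at `p` is proportionality with factor `0`, and `0 ^ k = 0` since `k ≥ 1`.
  have h := algHom_apply_eq_pow_mul (φ := sectionCoord (trivializationAt ℂ L p) p)
    (ψ := sectionCoord (trivializationAt ℂ L p) p) (c := 0)
    (forall_mem_span_range_eq_mul fun i => by
      rw [zero_mul]; exact congrFun h0 i) (hst l l)
  rw [zero_pow (by omega), zero_mul, map_mul] at h
  exact hl (mul_self_eq_zero.1 h)

/-- A factor `c` between the values of `t` at `q` and `p` becomes `c ^ k` on the products `sᵢ sₗ`;
dividing by `sₗ(p) ≠ 0` gives a factor for `s` independent of `i`. -/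
theorem exists_smul_homogCoords_of_mem_pow
    (hst : ∀ i j, (s i * s j : TensorSections L) ∈
      Submodule.span ℂ (Set.range fun i => (t i : TensorSections L)) ^ k)
    {p q : M} (hp : homogCoords s p ≠ 0) (hq : ∃ c : ℂ, c • homogCoords t q = homogCoords t p) :
    ∃ c : ℂ, c • homogCoords s q = homogCoords s p := by
  obtain ⟨c, hc⟩ := hq
  obtain ⟨l, hl⟩ := Function.ne_iff.1 hp
  have h : ∀ i, homogCoords s p i * homogCoords s p l =
      c ^ k * (homogCoords s q i * homogCoords s q l) := fun i => by
    have := algHom_apply_eq_pow_mul (φ := sectionCoord (trivializationAt ℂ L p) p)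
      (ψ := sectionCoord (trivializationAt ℂ L q) q)
      (forall_mem_span_range_eq_mul fun i => (congrFun hc i).symm) (hst i l)
    rwa [map_mul, map_mul] at this
  refine ⟨c ^ k * homogCoords s q l / homogCoords s p l, funext fun i => ?_⟩
  have hl' : homogCoords s p l ≠ 0 := hl
  rw [Pi.smul_apply, smul_eq_mul, div_mul_eq_mul_div, div_eq_iff hl', h i]
  ring

/-- Near `p`, `sᵢ / sₗ` is the quotient of `sᵢ sₗ / tⱼ ^ k` by `sₗ² / tⱼ ^ k`, both stationary as
polynomials in the ratios `tᵢ / tⱼ`. -/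
theorem stationaryAlong_homogCoords_of_mem_pow
    (hst : ∀ i j, (s i * s j : TensorSections L) ∈
      Submodule.span ℂ (Set.range fun i => (t i : TensorSections L)) ^ k)
    {p : M} {v : TangentSpace 𝓘(ℂ, EuclideanSpace ℂ (Fin n)) p} {j : Fin (N + 1)}
    {l : Fin (N' + 1)} (hj : homogCoords t p j ≠ 0) (hl : homogCoords s p l ≠ 0)
    (h : StationaryAlong _ p v (fun x i => homogCoords t x i / homogCoords t x j)) :
    StationaryAlong _ p v (fun x i => homogCoords s x i / homogCoords s x l) := by
  let φ := sectionCoord (trivializationAt ℂ L p)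
  have ht : ∀ i, StationaryAlong 𝓘(ℂ, EuclideanSpace ℂ (Fin n)) p v
      (fun x => φ x (t i) / φ x (t j)) := fun i =>
    (h.apply i).congr (homogCoords_div_eventuallyEq t p i j).symm
  have hu : ∀ i, StationaryAlong 𝓘(ℂ, EuclideanSpace ℂ (Fin n)) p v
      (fun x => φ x (s i * s l) / φ x (t j) ^ k) := fun i =>
    stationaryAlong_div_pow ht (hst i l)
  have hjp : φ p (t j) ≠ 0 := hj
  have hlp : φ p (s l) ≠ 0 := hl
  refine StationaryAlong.pi fun i => ((hu i).div (hu l) ?_).congr ?_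
  · rw [map_mul]
    exact div_ne_zero (mul_ne_zero hlp hlp) (pow_ne_zero k hjp)
  · have hcont : ContinuousAt (fun x => φ x (t j)) p :=
      (mdifferentiableAt_tensorCoord (t j) p).continuousAt
    filter_upwards [homogCoords_div_eventuallyEq s p i l, hcont.eventually_ne hjp] with x hx hjx
    rw [hx, div_div_div_cancel_right₀ (pow_ne_zero k hjx), map_mul, map_mul]
    change φ x (s i) / φ x (s l) = _
    -- Where `sₗ` vanishes both sides are `0`, as division by zero gives `0`.
    rcases eq_or_ne (φ x (s l)) 0 with h0 | h0
    · rw [h0]; simp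
    · rw [mul_div_mul_right _ _ h0]

/-- If the products `sᵢ sⱼ` of sections embedding `M` are homogeneous polynomials of degree `k ≥ 1`
in finitely many sections of `2L`, those sections embed `M` too. -/
theorem IsVeryAmple.two_of_forall_mem_pow (hk : 1 ≤ k) (hm : IsVeryAmple n L m)
    (hpow : ∀ u ∈ H0 n L (m + m), u ∈ H0 n L 2 ^ k) : IsVeryAmple n L 2 := by
  obtain ⟨N', s, hs, hinj, himm⟩ := hm
  obtain ⟨V, hVfg, hVW, hV⟩ := exists_fg_le_forall_mem_pow
    (u := fun ij : Fin (N' + 1) × Fin (N' + 1) => (s ij.1 * s ij.2 : TensorSections L))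
    fun ij => hpow _ (SetLike.mul_mem_graded (A := H0 n L) (s ij.1).2 (s ij.2).2)
  obtain ⟨N, t, rfl⟩ := exists_fin_succ_generating_family hVfg
  lift t to Fin (N + 1) → H0 n L 2 using
    fun i => hVW (Submodule.subset_span (Set.mem_range_self i))
  have hst : ∀ i j, (s i * s j : TensorSections L) ∈
      Submodule.span ℂ (Set.range fun i => (t i : TensorSections L)) ^ k := fun i j => hV (i, j)
  refine ⟨N, t, fun p => homogCoords_ne_zero_of_mem_pow hk hst (hs p), fun p q hpq => ?_,
    fun p j hj => ?_⟩
  · refine hinj ((Projectivization.mk_eq_mk_iff' ℂ _ _ _ _).2 ?_)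
    exact exists_smul_homogCoords_of_mem_pow hst (hs p)
      ((Projectivization.mk_eq_mk_iff' ℂ _ _ _ _).1 hpq)
  · obtain ⟨l, hl⟩ := Function.ne_iff.1 (hs p)
    -- A vector killed by the differential of `t` is killed by that of `s`, which is injective.
    refine (injective_iff_map_eq_zero _).2 fun v hv => ?_
    refine (injective_iff_map_eq_zero _).1 (himm p l hl) v ?_
    exact (stationaryAlong_homogCoords_of_mem_pow hst hj hl
      (stationaryAlong_of_mfderiv (mdifferentiableAt_homogCoords_div t hj) hv)).mfderiv_apply

end Sections

end Polarized


/-- `M` is a compact connected complex manifold of dimension `n` and `L` a holomorphic line bundle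
on `M`. -/
theorem mainTheorem2 (n : ℕ) {M : Type*} [TopologicalSpace M]
    [ChartedSpace (EuclideanSpace ℂ (Fin n)) M]
    [IsManifold 𝓘(ℂ, EuclideanSpace ℂ (Fin n)) ω M]
    [T2Space M] [CompactSpace M] [ConnectedSpace M]
    (L : M → Type*) [∀ x, AddCommGroup (L x)] [∀ x, Module ℂ (L x)]
    [TopologicalSpace (TotalSpace ℂ L)] [∀ x, TopologicalSpace (L x)]
    [FiberBundle ℂ L] [VectorBundle ℂ ℂ L]
    [ContMDiffVectorBundle ω ℂ L 𝓘(ℂ, EuclideanSpace ℂ (Fin n))]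
    (hample : Polarized.IsAmple n L) (heff : Polarized.IsEffective n L)
    (hgen : Polarized.IsGenerated n L 2) :
    Polarized.IsVeryAmple n L 2 := by
  obtain ⟨k, hk, hvery⟩ := hample
  exact hvery.two_of_forall_mem_pow hk fun u hu => hgen.mem_pow hk hu
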